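/- Let $X$ be a set (for instance $X\subseteq\mathbb{R}^n$), let $\mathcal F$ be a reproducing kernel Hilbert space of real-valued functions on $X$ with kernel $k$ and norm $\|\cdot\|$, and assume that $c_{\mathcal F}^2:=\sup_{x\in X}k(x,x)<\infty$, $c_{\mathcal F}\ge 0$. Let $Y_1\le Y_2$ be real numbers. Consider the following game: in each round $t=1,2,\dots$ a discount factor $\alpha_{t-1}\in(0,1]$ and an instance $x_t\in X$ are announced, then Learner announces a prediction $\gamma_t\in\mathbb{R}$, and then an outcome $y_t\in[Y_1,Y_2]$ is announced. Put $\beta_t=1/(\alpha_1\cdots\alpha_{t-1})$ (so $\beta_1=1$) and $B_T=\sum_{t=1}^T\beta_t$. Then there is a strategy for Learner (depending only on $\mathcal F,Y_1,Y_2$; its prediction $\gamma_t$ is a function of $\alpha_0,\dots,\alpha_{t-1}$, $x_1,\dots,x_t$, $y_1,\dots,y_{t-1}$ only, and no bound on $B_T/\beta_T$ is known in advance) such that, for all sequences of discount factors, instances and outcomes as above, for every positive integer $T$ and every $f\in\mathcal F$ with $f\neq 0$, $$\sum_{t=1}^T\frac{\beta_t}{\beta_T}(\gamma_t-y_t)^2\le\sum_{t=1}^T\frac{\beta_t}{\beta_T}(f(x_t)-y_t)^2+c_{\mathcal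 F}\|f\|(Y_2-Y_1)\sqrt{\frac{B_T}{\beta_T}}+\frac{(Y_2-Y_1)^2}{2}\ln\frac{B_T}{\beta_T}+\|f\|^2+(Y_2-Y_1)^2\ln\left(\frac{c_{\mathcal F}(Y_2-Y_1)}{\|f\|}+2\right).$$ -/

import Mathlib

open Finset

namespace DiscountedRegression

/-- A deterministic strategy for Learner in competitive online regression under general
discounting. Rounds are numbered `0, 1, 2, …`. In round `t` the prediction may depend on the discount
factors `α 0, …, α t` announced by Accountant so far, on the instances `x 0, …, x t`, and on the
past outcomes `y 0, …, y (t - 1)`, and on nothing else. Neither the future discount factors nor the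
number of rounds is available. -/
def Strategy (X : Type*) : Type _ :=
  (t : ℕ) → (Fin (t + 1) → ℝ) → (Fin (t + 1) → X) → (Fin t → ℝ) → ℝ

/-- The prediction issued in round `t` by the strategy `S` when the other players' moves are
`α`, `x`, `y`. -/
def Strategy.prediction {X : Type*} (S : Strategy X) (α : ℕ → ℝ) (x : ℕ → X) (y : ℕ → ℝ)
    (t : ℕ) : ℝ :=
  S t (fun i => α i) (fun i => x i) (fun i => y i)

/-- The weight `1 / (α 1 ⋯ α t)` of round `t` (rounds numbered from `0`, so that the first round
has weight `1`). The factor `α 0`, which would multiply the zero initial loss, plays no role. -/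
noncomputable def weight (α : ℕ → ℝ) (t : ℕ) : ℝ :=
  1 / ∏ i ∈ range t, α (i + 1)

/-- The discounted cumulative square loss after round `T`, that is, after `T + 1` rounds,
of the sequence of predictions `p` on the outcomes `y`. -/
noncomputable def discountedLoss (α p y : ℕ → ℝ) (T : ℕ) : ℝ :=
  ∑ t ∈ range (T + 1), weight α t / weight α T * (p t - y t) ^ 2

/-- The normalized total weight of the rounds `0, …, T`. -/
noncomputable def effectiveTime (α : ℕ → ℝ) (T : ℕ) : ℝ :=
  (∑ t ∈ range (T + 1), weight α t) / weight α T

section Kernel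

variable {X : Type*} (F : Type*) [NormedAddCommGroup F] [InnerProductSpace ℝ F]
  [CompleteSpace F] [RKHS ℝ F X ℝ]

/-- The reproducing kernel `k : X × X → ℝ` of a Hilbert space of real-valued functions on `X`. -/
noncomputable def realKernel (x x' : X) : ℝ := RKHS.kernel F x x' 1

/-- The constant `c_F`, the square root of `sup_x k(x, x)`, of a reproducing kernel Hilbert space
with a kernel bounded on the diagonal. -/
noncomputable def kernelBound : ℝ := Real.sqrt (⨆ x : X, realKernel F x x)

end Kernel

end DiscountedRegression

/-! Learner aggregates random functions. The square loss is mixable at rate η = 2 / D², where D = Y₂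
- Y₁: some prediction exponentially dominates any mixture of experts (`exists_mixing_prediction`).
So exp(-η · Learner's loss) stays above the prior mean of exp(-η · expert's loss). Discounting
raises these quantities to a power α ≤ 1, and Jensen's inequality for the concave u ↦ u ^ α
preserves the comparison (`integral_exp_neg_discountedLoss_le`).

The experts are paths of a centred Gaussian process with covariance σ²k, realized causally by
Gram–Schmidt on the kernel sections seen so far. Shifting the Gaussian law to be centred at f and
applying Jensen's inequality to exp bounds the prior mean from below: the path noise costs at most
σ²c² per unit of effective time, the shift costs ‖f‖² / (2ησ²) (`exp_le_integral_gaussianExpert`).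

The best σ depends on ‖f‖ and on the unknown effective time, so the prior also mixes over σ² = D² /
(4(n + 1)), at an extra cost of log((n + 1)(n + 2)) / η. In the analysis n is chosen to balance
noise against shift (`exists_regularization_le`). -/

namespace DiscountedRegression

/-! ### Mixability of the square loss -/

open MeasureTheory ProbabilityTheory in
/-- Hoeffding's lemma for a variable with values `±1` and mean `s`. -/
theorem bernoulli_mgf_le {s : ℝ} (h1 : -1 ≤ s) (h2 : s ≤ 1) (d : ℝ) :
    (1 + s) * Real.exp d + (1 - s) * Real.exp (-d) ≤ 2 * Real.exp (s * d + d ^ 2 / 2) := by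
  let μ : Measure ℝ := ENNReal.ofReal ((1 + s) / 2) • Measure.dirac 1
    + ENNReal.ofReal ((1 - s) / 2) • Measure.dirac (-1)
  have hint : ∀ g : ℝ → ℝ, ∫ x, g x ∂μ = (1 + s) / 2 * g 1 + (1 - s) / 2 * g (-1) := by
    intro g
    have hi : ∀ (a b : ℝ), Integrable g (ENNReal.ofReal a • Measure.dirac b) := fun a b =>
      (integrable_dirac (by simp)).smul_measure ENNReal.ofReal_ne_top
    rw [integral_add_measure (hi _ _) (hi _ _), integral_smul_measure, integral_smul_measure,
      integral_dirac, integral_dirac, ENNReal.toReal_ofReal (by linarith),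
      ENNReal.toReal_ofReal (by linarith)]
    simp
  have : IsProbabilityMeasure μ := ⟨by
    simp only [μ, Measure.add_apply, Measure.smul_apply, measure_univ, smul_eq_mul, mul_one]
    rw [← ENNReal.ofReal_add (by linarith) (by linarith)]
    norm_num [← add_div]⟩
  have hb : ∀ᵐ x ∂μ, (id x : ℝ) ∈ Set.Icc (-1 : ℝ) 1 := by
    rw [ae_iff]
    simp [μ]
  have h := (hasSubgaussianMGF_of_mem_Icc (X := id) aemeasurable_id hb).mgf_le d
  have hmean : ∫ x, id x ∂μ = s := by rw [hint]; simp; ring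
  rw [mgf, hmean, hint] at h
  have hc : (((‖(1 : ℝ) - -1‖₊ / 2) ^ 2 : NNReal) : ℝ) = 1 := by
    norm_num
  rw [hc] at h
  have e1 : Real.exp (s * d + d ^ 2 / 2) = Real.exp (s * d) * Real.exp (1 * d ^ 2 / 2) := by
    rw [← Real.exp_add]; ring_nf
  have e2 : Real.exp d = Real.exp (s * d) * Real.exp (d * (id 1 - s)) := by
    rw [← Real.exp_add]; simp; ring_nf
  have e3 : Real.exp (-d) = Real.exp (s * d) * Real.exp (d * (id (-1) - s)) := by
    rw [← Real.exp_add]; simp; ring_nf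
  rw [e1, e2, e3]
  nlinarith [mul_le_mul_of_nonneg_left h (Real.exp_pos (s * d)).le]

open MeasureTheory in
/-- The square loss with outcomes in `[-1, 1]` is `1/2`-mixable, for predictions on the whole
line. -/
theorem exists_mixing_prediction_unit {Ω : Type*} [MeasurableSpace Ω] (ν : Measure Ω)
    [IsProbabilityMeasure ν] {p : Ω → ℝ} (hp : Measurable p) :
    ∃ γ : ℝ, ∀ y ∈ Set.Icc (-1 : ℝ) 1,
      ∫ ω, Real.exp (-(p ω - y) ^ 2 / 2) ∂ν ≤ Real.exp (-(γ - y) ^ 2 / 2) := by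
  -- The factor exp(-y² / 2), common to all experts and to γ, is stripped off.
  let a : ℝ → ℝ := fun y => ∫ ω, Real.exp (p ω * y - p ω ^ 2 / 2) ∂ν
  have hbd : ∀ q y : ℝ, Real.exp (q * y - q ^ 2 / 2) ≤ Real.exp (y ^ 2 / 2) := fun q y =>
    Real.exp_le_exp.2 (by nlinarith [sq_nonneg (q - y)])
  have hi : ∀ y, Integrable (fun ω => Real.exp (p ω * y - p ω ^ 2 / 2)) ν := fun y =>
    Integrable.of_bound (by fun_prop) (Real.exp (y ^ 2 / 2)) (.of_forall fun ω => by
      rw [Real.norm_eq_abs, Real.abs_exp]; exact hbd _ _)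
  have hapos : ∀ y, 0 < a y := fun y => integral_exp_pos (hi y)
  have hale : ∀ y, a y ≤ Real.exp (y ^ 2 / 2) := fun y => by
    have := integral_mono (hi y) (integrable_const (μ := ν) (Real.exp (y ^ 2 / 2)))
      (fun ω => hbd (p ω) y)
    simpa using this
  -- The endpoints suffice: exp((p - γ)y) is convex in y, so it lies below its chord over [-1, 1].
  suffices h : ∃ γ : ℝ, a 1 ≤ Real.exp (γ - γ ^ 2 / 2) ∧ a (-1) ≤ Real.exp (-γ - γ ^ 2 / 2) by
    obtain ⟨γ, h1, h2⟩ := h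
    refine ⟨γ, fun y hy => ?_⟩
    have key : a y ≤ Real.exp (γ * y - γ ^ 2 / 2) := by
      have hpt : ∀ ω, Real.exp (p ω * y - p ω ^ 2 / 2) ≤
          (1 + y) / 2 * Real.exp (γ * (y - 1)) * Real.exp (p ω * 1 - p ω ^ 2 / 2)
          + (1 - y) / 2 * Real.exp (γ * (y + 1)) * Real.exp (p ω * (-1) - p ω ^ 2 / 2) := by
        intro ω
        have hc := convexOn_exp.2 (Set.mem_univ (p ω - γ)) (Set.mem_univ (-(p ω - γ)))
          (by linarith [hy.1] : 0 ≤ (1 + y) / 2) (by linarith [hy.2] : 0 ≤ (1 - y) / 2) (by ring)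
        simp only [smul_eq_mul] at hc
        have hm := mul_le_mul_of_nonneg_left hc (Real.exp_pos (γ * y - p ω ^ 2 / 2)).le
        rw [mul_add, ← mul_assoc, ← mul_assoc, mul_comm (Real.exp _) ((1 + y) / 2),
          mul_comm (Real.exp (γ * y - p ω ^ 2 / 2)) ((1 - y) / 2), mul_assoc, mul_assoc,
          ← Real.exp_add, ← Real.exp_add, ← Real.exp_add] at hm
        rw [mul_assoc, mul_assoc, ← Real.exp_add, ← Real.exp_add]
        ring_nf at hm ⊢; exact hm
      have := integral_mono (hi y) (((hi 1).const_mul _).add ((hi (-1)).const_mul _)) hpt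
      simp only [Pi.add_apply] at this
      rw [integral_add ((hi 1).const_mul _) ((hi (-1)).const_mul _), integral_const_mul,
        integral_const_mul] at this
      refine this.trans ?_
      have e1 := mul_le_mul_of_nonneg_left h1
        (mul_nonneg (by linarith [hy.1] : 0 ≤ (1 + y) / 2) (Real.exp_pos (γ * (y - 1))).le)
      have e2 := mul_le_mul_of_nonneg_left h2
        (mul_nonneg (by linarith [hy.2] : 0 ≤ (1 - y) / 2) (Real.exp_pos (γ * (y + 1))).le)
      rw [mul_assoc _ _ (Real.exp (γ - _)), ← Real.exp_add] at e1
      rw [mul_assoc _ _ (Real.exp (-γ - _)), ← Real.exp_add] at e2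
      have e3 : γ * (y - 1) + (γ - γ ^ 2 / 2) = γ * y - γ ^ 2 / 2 := by ring
      have e4 : γ * (y + 1) + (-γ - γ ^ 2 / 2) = γ * y - γ ^ 2 / 2 := by ring
      rw [e3] at e1
      rw [e4] at e2
      simp only [a] at e1 e2
      linarith
    have hrw : ∀ q : ℝ, Real.exp (-(q - y) ^ 2 / 2)
        = Real.exp (-y ^ 2 / 2) * Real.exp (q * y - q ^ 2 / 2) := fun q => by
      rw [← Real.exp_add]; ring_nf
    simp_rw [hrw]
    rw [integral_const_mul]
    exact mul_le_mul_of_nonneg_left key (Real.exp_pos _).le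
  obtain ⟨r, hr⟩ : ∃ r, Real.exp r = a 1 := ⟨_, Real.exp_log (hapos 1)⟩
  obtain ⟨q, hq⟩ : ∃ q, Real.exp q = a (-1) := ⟨_, Real.exp_log (hapos (-1))⟩
  have hr1 : r ≤ 1 / 2 := by
    have := hale 1; rw [← hr] at this; simpa using Real.exp_le_exp.1 this
  have hq1 : q ≤ 1 / 2 := by
    have := hale (-1); rw [← hq] at this; simpa using Real.exp_le_exp.1 this
  rw [← hr, ← hq]
  simp only [Real.exp_le_exp]
  -- This γ makes r - γ and q + γ equal. If it leaves [-1, 1], the nearer endpoint works because r,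
  -- q ≤ 1/2; otherwise Hoeffding's bound at d = p - s, integrated, gives (r + q) / 2 ≤ -s² / 2.
  set s := (r - q) / 2 with hs
  by_cases hs1 : 1 < s
  · exact ⟨1, by linarith, by linarith⟩
  by_cases hs2 : s < -1
  · exact ⟨-1, by linarith, by linarith⟩
  push Not at hs1 hs2
  have hpt : ∀ ω, (1 + s) * Real.exp (-s) * Real.exp (p ω * 1 - p ω ^ 2 / 2)
      + (1 - s) * Real.exp s * Real.exp (p ω * (-1) - p ω ^ 2 / 2)
      ≤ 2 * Real.exp (-s ^ 2 / 2) := by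
    intro ω
    have hm := mul_le_mul_of_nonneg_right (bernoulli_mgf_le hs2 hs1 (p ω - s))
      (Real.exp_pos (-p ω ^ 2 / 2)).le
    rw [add_mul, mul_assoc, mul_assoc, mul_assoc, ← Real.exp_add, ← Real.exp_add,
      ← Real.exp_add] at hm
    rw [mul_assoc, mul_assoc, ← Real.exp_add, ← Real.exp_add]
    ring_nf at hm ⊢; exact hm
  have := integral_mono (((hi 1).const_mul _).add ((hi (-1)).const_mul _))
    (integrable_const (μ := ν) _) hpt
  simp only [Pi.add_apply] at this
  rw [integral_add ((hi 1).const_mul _) ((hi (-1)).const_mul _), integral_const_mul,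
    integral_const_mul] at this
  change (1 + s) * Real.exp (-s) * a 1 + (1 - s) * Real.exp s * a (-1) ≤ _ at this
  rw [← hr, ← hq, mul_assoc, mul_assoc, ← Real.exp_add, ← Real.exp_add] at this
  have e1 : -s + r = (r + q) / 2 := by rw [hs]; ring
  have e2 : s + q = (r + q) / 2 := by rw [hs]; ring
  rw [e1, e2] at this
  simp only [integral_const, probReal_univ, smul_eq_mul, one_mul] at this
  have h4 : Real.exp ((r + q) / 2) ≤ Real.exp (-s ^ 2 / 2) := by linarith
  have h5 := Real.exp_le_exp.1 h4
  exact ⟨s, by linarith, by linarith⟩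

open MeasureTheory in
/-- The square loss with outcomes in `[Y₁, Y₂]` is `2 / (Y₂ - Y₁) ^ 2`-mixable, for predictions on
the whole line and nonnegative weights `w`. -/
theorem exists_mixing_prediction {Ω : Type*} [MeasurableSpace Ω] (P : Measure Ω)
    {Y₁ Y₂ : ℝ} (hY : Y₁ < Y₂) {p w : Ω → ℝ} (hp : Measurable p) (hw : Measurable w)
    (hw0 : ∀ ω, 0 ≤ w ω) (hwi : Integrable w P) (hwpos : 0 < ∫ ω, w ω ∂P) :
    ∃ γ : ℝ, ∀ y ∈ Set.Icc Y₁ Y₂,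
      ∫ ω, w ω * Real.exp (-(2 / (Y₂ - Y₁) ^ 2 * (p ω - y) ^ 2)) ∂P ≤
        (∫ ω, w ω ∂P) * Real.exp (-(2 / (Y₂ - Y₁) ^ 2 * (γ - y) ^ 2)) := by
  set N := ∫ ω, w ω ∂P with hN
  have hD : 0 < Y₂ - Y₁ := sub_pos.2 hY
  let ν : Measure Ω := P.withDensity fun ω => ENNReal.ofReal (w ω / N)
  have hν : IsProbabilityMeasure ν := ⟨by
    simp only [ν]
    rw [withDensity_apply _ .univ, Measure.restrict_univ,
      ← ofReal_integral_eq_lintegral_ofReal (hwi.div_const N)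
        (.of_forall fun ω => div_nonneg (hw0 ω) hwpos.le), integral_div, ← hN,
      div_self hwpos.ne', ENNReal.ofReal_one]⟩
  -- The affine map of [Y₁, Y₂] onto [-1, 1] has slope 2 / (Y₂ - Y₁), which turns the rate 1/2 into
  -- 2 / (Y₂ - Y₁)².
  obtain ⟨g, hg⟩ := exists_mixing_prediction_unit ν
    (p := fun ω => (2 * p ω - (Y₁ + Y₂)) / (Y₂ - Y₁)) (by fun_prop)
  refine ⟨((Y₂ - Y₁) * g + (Y₁ + Y₂)) / 2, fun y hy => ?_⟩
  have hy' : (2 * y - (Y₁ + Y₂)) / (Y₂ - Y₁) ∈ Set.Icc (-1 : ℝ) 1 := by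
    constructor
    · rw [le_div_iff₀ hD]; linarith [hy.1]
    · rw [div_le_iff₀ hD]; linarith [hy.2]
  have h := hg _ hy'
  simp only [ν] at h
  rw [integral_withDensity_eq_integral_toReal_smul (by fun_prop) (by simp)] at h
  have e1 : ∀ ω, (ENNReal.ofReal (w ω / N)).toReal • Real.exp
      (-((2 * p ω - (Y₁ + Y₂)) / (Y₂ - Y₁) - (2 * y - (Y₁ + Y₂)) / (Y₂ - Y₁)) ^ 2 / 2)
      = N⁻¹ * (w ω * Real.exp (-(2 / (Y₂ - Y₁) ^ 2 * (p ω - y) ^ 2))) := by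
    intro ω
    rw [ENNReal.toReal_ofReal (div_nonneg (hw0 ω) hwpos.le), smul_eq_mul, div_eq_inv_mul, mul_assoc]
    congr 3
    field_simp
    ring
  simp_rw [e1] at h
  rw [integral_const_mul, inv_mul_le_iff₀ hwpos] at h
  refine h.trans (le_of_eq ?_)
  congr 2
  field_simp
  ring

/-! ### Discounted losses -/

/-- The cumulative loss of the rounds before `t`, discounted to round `t`. -/
noncomputable def pastLoss (α p y : ℕ → ℝ) (t : ℕ) : ℝ :=
  ∑ i ∈ range t, weight α i / weight α t * (p i - y i) ^ 2

theorem weight_pos {α : ℕ → ℝ} (hα : ∀ t, α t ∈ Set.Ioc (0 : ℝ) 1) (t : ℕ) : 0 < weight α t :=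
  one_div_pos.2 (prod_pos fun i _ => (hα (i + 1)).1)

theorem discountedLoss_eq_pastLoss_add {α : ℕ → ℝ} (hα : ∀ t, α t ∈ Set.Ioc (0 : ℝ) 1)
    (p y : ℕ → ℝ) (t : ℕ) :
    discountedLoss α p y t = pastLoss α p y t + (p t - y t) ^ 2 := by
  rw [discountedLoss, sum_range_succ, div_self (weight_pos hα t).ne', one_mul, pastLoss]

theorem pastLoss_succ {α : ℕ → ℝ} (hα : ∀ t, α t ∈ Set.Ioc (0 : ℝ) 1) (p y : ℕ → ℝ) (t : ℕ) :
    pastLoss α p y (t + 1) = α (t + 1) * discountedLoss α p y t := by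
  rw [pastLoss, discountedLoss, mul_sum]
  refine sum_congr rfl fun i _ => ?_
  have h : ∏ j ∈ range t, α (j + 1) ≠ 0 := (prod_pos fun i _ => (hα (i + 1)).1).ne'
  have h' := (hα (t + 1)).1.ne'
  rw [weight, weight, weight, prod_range_succ]
  field_simp

theorem discountedLoss_nonneg {α : ℕ → ℝ} (hα : ∀ t, α t ∈ Set.Ioc (0 : ℝ) 1) (p y : ℕ → ℝ)
    (t : ℕ) : 0 ≤ discountedLoss α p y t :=
  sum_nonneg fun i _ =>
    mul_nonneg (div_nonneg (weight_pos hα i).le (weight_pos hα t).le) (sq_nonneg _)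

theorem pastLoss_nonneg {α : ℕ → ℝ} (hα : ∀ t, α t ∈ Set.Ioc (0 : ℝ) 1) (p y : ℕ → ℝ)
    (t : ℕ) : 0 ≤ pastLoss α p y t :=
  sum_nonneg fun i _ =>
    mul_nonneg (div_nonneg (weight_pos hα i).le (weight_pos hα t).le) (sq_nonneg _)

theorem pastLoss_congr {α α' p p' y y' : ℕ → ℝ} {t : ℕ} (hα : ∀ i ≤ t, α i = α' i)
    (hp : ∀ i < t, p i = p' i) (hy : ∀ i < t, y i = y' i) :
    pastLoss α p y t = pastLoss α' p' y' t := by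
  have hw : ∀ i ≤ t, weight α i = weight α' i := fun i hi => by
    rw [weight, weight, prod_congr rfl fun j hj => hα (j + 1) ?_]
    have := mem_range.1 hj
    omega
  refine sum_congr rfl fun i hi => ?_
  have := mem_range.1 hi
  rw [hw i this.le, hw t le_rfl, hp i this, hy i this]

/-! ### Aggregation under discounting -/

section Aggregation

open MeasureTheory

variable {Ω : Type*} [MeasurableSpace Ω]

@[fun_prop]
theorem measurable_pastLoss (α y : ℕ → ℝ) {p : ℕ → Ω → ℝ} (hp : ∀ t, Measurable (p t)) (t : ℕ) :
    Measurable fun ω => pastLoss α (fun i => p i ω) y t := by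
  unfold pastLoss
  fun_prop

@[fun_prop]
theorem measurable_discountedLoss (α y : ℕ → ℝ) {p : ℕ → Ω → ℝ} (hp : ∀ t, Measurable (p t))
    (t : ℕ) : Measurable fun ω => discountedLoss α (fun i => p i ω) y t := by
  unfold discountedLoss
  fun_prop

/-- A prediction whose square loss is at most the mixed loss of the experts with predictions `p` and
weights `w`, whatever the outcome in `[Y₁, Y₂]`. -/
noncomputable def mixingPrediction (P : Measure Ω) (Y₁ Y₂ : ℝ) (w p : Ω → ℝ) : ℝ :=
  Classical.epsilon fun γ => ∀ y ∈ Set.Icc Y₁ Y₂,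
    ∫ ω, w ω * Real.exp (-(2 / (Y₂ - Y₁) ^ 2 * (p ω - y) ^ 2)) ∂P ≤
      (∫ ω, w ω ∂P) * Real.exp (-(2 / (Y₂ - Y₁) ^ 2 * (γ - y) ^ 2))

theorem integrable_exp_neg_of_nonneg {P : Measure Ω} [IsFiniteMeasure P] {g : Ω → ℝ}
    (hg : Measurable g) (h0 : ∀ ω, 0 ≤ g ω) : Integrable (fun ω => Real.exp (-g ω)) P :=
  Integrable.of_bound (by fun_prop) 1 (.of_forall fun ω => by
    rw [Real.norm_eq_abs, Real.abs_exp]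
    exact Real.exp_le_one_iff.2 (by linarith [h0 ω]))

/-- Within a round, mixability carries the inequality from past loss to current loss. Between rounds
both losses are multiplied by the discount factor, and ∫ u ^ α ≤ (∫ u) ^ α. -/
theorem integral_exp_neg_discountedLoss_le (P : Measure Ω) [IsProbabilityMeasure P] {Y₁ Y₂ : ℝ}
    (hY : Y₁ < Y₂) {α y γ : ℕ → ℝ} {p : ℕ → Ω → ℝ} (hα : ∀ t, α t ∈ Set.Ioc (0 : ℝ) 1)
    (hy : ∀ t, y t ∈ Set.Icc Y₁ Y₂) (hp : ∀ t, Measurable (p t))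
    (hγ : ∀ t, γ t = mixingPrediction P Y₁ Y₂
      (fun ω => Real.exp (-(2 / (Y₂ - Y₁) ^ 2 * pastLoss α (fun i => p i ω) y t))) (p t))
    (T : ℕ) :
    ∫ ω, Real.exp (-(2 / (Y₂ - Y₁) ^ 2 * discountedLoss α (fun i => p i ω) y T)) ∂P ≤
      Real.exp (-(2 / (Y₂ - Y₁) ^ 2 * discountedLoss α γ y T)) := by
  set η := 2 / (Y₂ - Y₁) ^ 2 with hη
  have hη0 : 0 ≤ η := by positivity
  have hpi : ∀ t, Integrable (fun ω => Real.exp (-(η * pastLoss α (fun i => p i ω) y t))) P :=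
    fun t => integrable_exp_neg_of_nonneg (by fun_prop)
      fun ω => mul_nonneg hη0 (pastLoss_nonneg hα _ _ _)
  have hdi : ∀ t, Integrable
      (fun ω => Real.exp (-(η * discountedLoss α (fun i => p i ω) y t))) P :=
    fun t => integrable_exp_neg_of_nonneg (by fun_prop)
      fun ω => mul_nonneg hη0 (discountedLoss_nonneg hα _ _ _)
  have step : ∀ t, ∫ ω, Real.exp (-(η * pastLoss α (fun i => p i ω) y t)) ∂P ≤
      Real.exp (-(η * pastLoss α γ y t)) →
      ∫ ω, Real.exp (-(η * discountedLoss α (fun i => p i ω) y t)) ∂P ≤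
      Real.exp (-(η * discountedLoss α γ y t)) := by
    intro t ht
    have hmix := Classical.epsilon_spec (exists_mixing_prediction P hY (hp t)
      (w := fun ω => Real.exp (-(η * pastLoss α (fun i => p i ω) y t))) (by fun_prop)
      (fun ω => (Real.exp_pos _).le) (hpi t) (integral_exp_pos (hpi t))) (y t) (hy t)
    have e := hγ t
    rw [mixingPrediction] at e
    rw [← e, ← hη] at hmix
    simp_rw [← Real.exp_add, ← neg_add, ← mul_add, ← discountedLoss_eq_pastLoss_add hα] at hmix
    refine hmix.trans ((mul_le_mul_of_nonneg_right ht (Real.exp_pos _).le).trans (le_of_eq ?_))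
    rw [← Real.exp_add, ← neg_add, ← mul_add, discountedLoss_eq_pastLoss_add hα]
  induction T with
  | zero => exact step 0 (by simp [pastLoss])
  | succ t ih =>
    refine step (t + 1) ?_
    have ha := hα (t + 1)
    have hexp : ∀ p : ℕ → ℝ, Real.exp (-(η * pastLoss α p y (t + 1))) =
        Real.exp (-(η * discountedLoss α p y t)) ^ (α (t + 1)) := fun p => by
      rw [← Real.exp_mul, pastLoss_succ hα]; ring_nf
    simp_rw [hexp]
    have hj := (Real.concaveOn_rpow ha.1.le ha.2).le_map_integral (μ := P)
      (f := fun ω => Real.exp (-(η * discountedLoss α (fun i => p i ω) y t)))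
      (Real.continuous_rpow_const ha.1.le).continuousOn isClosed_Ici
      (.of_forall fun ω => (Real.exp_pos _).le) (hdi t) (by
        have := hpi (t + 1)
        simp_rw [hexp] at this
        exact this)
    refine hj.trans (Real.rpow_le_rpow (integral_nonneg fun ω => (Real.exp_pos _).le) ih ha.1.le)

/-- The strategy that mixes the experts `p x · ω` with respect to the prior `P`. -/
noncomputable def mixingStrategy {X : Type*} (P : Measure Ω) (Y₁ Y₂ : ℝ)
    (p : (ℕ → X) → ℕ → Ω → ℝ) : Strategy X := fun t α x y =>
  -- Finite histories are padded to sequences: indices wrap modulo t + 1 and missing outcomes are 0.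
  -- With causal experts the padding is never read.
  mixingPrediction P Y₁ Y₂
    (fun ω => Real.exp (-(2 / (Y₂ - Y₁) ^ 2 *
      pastLoss (fun i => α (Fin.ofNat (t + 1) i)) (fun i => p (fun i => x (Fin.ofNat (t + 1) i)) i ω)
        (fun i => if h : i < t then y ⟨i, h⟩ else 0) t)))
    (p (fun i => x (Fin.ofNat (t + 1) i)) t)

theorem prediction_mixingStrategy {X : Type*} (P : Measure Ω) (Y₁ Y₂ : ℝ)
    {p : (ℕ → X) → ℕ → Ω → ℝ}
    (hp : ∀ x x' t, (∀ i ≤ t, x i = x' i) → p x t = p x' t) (α : ℕ → ℝ) (x : ℕ → X) (y : ℕ → ℝ)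
    (t : ℕ) :
    (mixingStrategy P Y₁ Y₂ p).prediction α x y t = mixingPrediction P Y₁ Y₂
      (fun ω => Real.exp (-(2 / (Y₂ - Y₁) ^ 2 * pastLoss α (fun i => p x i ω) y t))) (p x t) := by
  have hmod : ∀ i ≤ t, ((Fin.ofNat (t + 1) i : Fin (t + 1)) : ℕ) = i := fun i hi =>
    Nat.mod_eq_of_lt (by omega)
  have hx : ∀ i ≤ t, p (fun i => x (Fin.ofNat (t + 1) i : Fin (t + 1))) i = p x i := fun i hi =>
    hp _ _ _ fun j hj => by rw [hmod j (hj.trans hi)]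
  rw [Strategy.prediction, mixingStrategy, hx t le_rfl]
  congr 1
  funext ω
  rw [pastLoss_congr (α' := α) (p' := fun i => p x i ω) (y' := y)]
  · intro i hi
    simp only [hmod i hi]
  · intro i hi
    simp only [hx i hi.le]
  · intro i hi
    simp [hi]

end Aggregation

/-! ### Shifts of Gaussian measures -/

section Gaussian

open MeasureTheory ProbabilityTheory

/-- Expanding (x + m)² / 2 leaves this density ratio, the one-dimensional case of
`map_sub_stdGaussianPi`. -/
theorem gaussianReal_neg_one_eq_withDensity (m : ℝ) :
    gaussianReal (-m) 1 = (gaussianReal 0 1).withDensity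
      fun x => ENNReal.ofReal (Real.exp (-(m * x) - m ^ 2 / 2)) := by
  rw [gaussianReal_of_var_ne_zero _ one_ne_zero, gaussianReal_of_var_ne_zero _ one_ne_zero,
    ← withDensity_mul _ (by fun_prop) (by fun_prop)]
  congr 1
  funext x
  simp only [gaussianPDF, gaussianPDFReal, Pi.mul_apply]
  rw [← ENNReal.ofReal_mul (by positivity), mul_assoc _ (Real.exp _), ← Real.exp_add]
  congr 3
  push_cast
  ring

variable {ι : Type*} [Fintype ι]

/-- The standard Gaussian measure on `ι → ℝ`. -/
noncomputable def stdGaussianPi (ι : Type*) [Fintype ι] : Measure (ι → ℝ) :=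
  Measure.pi fun _ => gaussianReal 0 1

instance : IsProbabilityMeasure (stdGaussianPi ι) := by unfold stdGaussianPi; infer_instance

/-- The Cameron–Martin formula for the standard Gaussian measure. -/
theorem map_sub_stdGaussianPi (m : ι → ℝ) :
    (stdGaussianPi ι).map (fun ξ => ξ - m) = (stdGaussianPi ι).withDensity
      fun ξ => ENNReal.ofReal (Real.exp (-(∑ i, m i * ξ i) - (∑ i, m i ^ 2) / 2)) := by
  have hpm : ∀ i, IsProbabilityMeasure ((gaussianReal 0 1).map fun x => x - m i) := fun i =>
    Measure.isProbabilityMeasure_map (by fun_prop)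
  have h1 : (stdGaussianPi ι).map (fun ξ => ξ - m) =
      Measure.pi fun i => gaussianReal (-m i) 1 := by
    have := Measure.pi_map_pi (μ := fun _ : ι => gaussianReal 0 1) (f := fun i (x : ℝ) => x - m i)
      (hμ := fun i => inferInstance) (fun i => by fun_prop)
    simp only [gaussianReal_map_sub_const, zero_sub] at this
    exact this
  rw [h1]
  refine Measure.pi_eq fun s hs => ?_
  rw [withDensity_apply _ (MeasurableSet.univ_pi hs), ← lintegral_indicator (.univ_pi hs)]
  -- On a box the density times the indicator factors over coordinates, so independence splits the
  -- integral.
  have hind : iIndepFun (fun i (ξ : ι → ℝ) => (s i).indicator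
      (fun x => ENNReal.ofReal (Real.exp (-(m i * x) - m i ^ 2 / 2))) (ξ i))
      (stdGaussianPi ι) :=
    iIndepFun_pi (μ := fun _ : ι => gaussianReal 0 1) (X := fun i => (s i).indicator
      (fun x => ENNReal.ofReal (Real.exp (-(m i * x) - m i ^ 2 / 2))))
      fun i => (Measurable.indicator (by fun_prop) (hs i)).aemeasurable
  have hprod := lintegral_prod_eq_prod_lintegral_of_indepFun univ _ hind fun i =>
    (Measurable.indicator (by fun_prop) (hs i)).comp (measurable_pi_apply i)
  have hL : ∀ ξ : ι → ℝ, (Set.univ.pi s).indicator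
      (fun ξ => ENNReal.ofReal (Real.exp (-(∑ i, m i * ξ i) - (∑ i, m i ^ 2) / 2))) ξ =
      ∏ i, (s i).indicator
        (fun x => ENNReal.ofReal (Real.exp (-(m i * x) - m i ^ 2 / 2))) (ξ i) := by
    intro ξ
    by_cases h : ξ ∈ Set.univ.pi s
    · rw [Set.indicator_of_mem h, prod_congr rfl fun i _ =>
        Set.indicator_of_mem (h i (Set.mem_univ i)) _,
        ← ENNReal.ofReal_prod_of_nonneg fun i _ => (Real.exp_pos _).le, ← Real.exp_sum,
        sum_sub_distrib, sum_neg_distrib, sum_div]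
    · rw [Set.indicator_of_notMem h]
      obtain ⟨i, hi⟩ : ∃ i, ξ i ∉ s i := by simpa [Set.mem_pi] using h
      exact (prod_eq_zero (mem_univ i) (Set.indicator_of_notMem hi _)).symm
  rw [lintegral_congr hL, hprod]
  refine prod_congr rfl fun i _ => ?_
  rw [gaussianReal_neg_one_eq_withDensity, withDensity_apply _ (hs i),
    ← lintegral_indicator (hs i), stdGaussianPi]
  exact (measurePreserving_eval (fun _ : ι => gaussianReal 0 1) i).lintegral_comp
    (Measurable.indicator (by fun_prop) (hs i))

theorem memLp_eval_stdGaussianPi (i : ι) : MemLp (fun ξ : ι → ℝ => ξ i) 2 (stdGaussianPi ι) :=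
  (memLp_id_gaussianReal' 2 (by simp)).comp_measurePreserving
    (measurePreserving_eval (fun _ : ι => gaussianReal 0 1) i)

theorem integral_eval_stdGaussianPi (i : ι) : ∫ ξ, ξ i ∂stdGaussianPi ι = 0 := by
  rw [stdGaussianPi, integral_eval]
  exact integral_id_gaussianReal

theorem memLp_linear_stdGaussianPi (A : ι → ℝ) :
    MemLp (fun ξ : ι → ℝ => ∑ i, A i * ξ i) 2 (stdGaussianPi ι) :=
  memLp_finsetSum _ fun i _ => (memLp_eval_stdGaussianPi i).const_mul (A i)

theorem integral_linear_stdGaussianPi (A : ι → ℝ) :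
    ∫ ξ, ∑ i, A i * ξ i ∂stdGaussianPi ι = 0 := by
  rw [integral_finsetSum _ fun i _ =>
    ((memLp_eval_stdGaussianPi i).integrable one_le_two).const_mul (A i)]
  simp [integral_const_mul, integral_eval_stdGaussianPi]

theorem integral_linear_sq_stdGaussianPi (A : ι → ℝ) :
    ∫ ξ, (∑ i, A i * ξ i) ^ 2 ∂stdGaussianPi ι = ∑ i, A i ^ 2 := by
  have h := variance_sum_pi (μ := fun _ : ι => gaussianReal 0 1) (X := fun i x => A i * x)
    (fun i => (memLp_id_gaussianReal' 2 (by simp)).const_mul (A i))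
  have h2 := variance_of_integral_eq_zero (memLp_linear_stdGaussianPi A).aemeasurable
    (integral_linear_stdGaussianPi A)
  rw [← h2]
  convert h using 1
  · rw [stdGaussianPi]
    congr 1
    funext ξ
    simp
  · refine sum_congr rfl fun i _ => ?_
    rw [variance_const_mul]
    have := variance_id_gaussianReal (μ := 0) (v := 1)
    change _ = _ * Var[id; gaussianReal 0 1]
    rw [this]
    simp

/-- A lower bound for a Gaussian integral of Laplace type: Jensen's inequality after a shift of the
measure. -/
theorem exp_le_integral_exp_neg_stdGaussianPi {g : (ι → ℝ) → ℝ} (hg : Measurable g)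
    (hg0 : ∀ ξ, 0 ≤ g ξ) (m : ι → ℝ) (hi : Integrable (fun ξ => g (ξ + m)) (stdGaussianPi ι)) :
    Real.exp (-(∫ ξ, g (ξ + m) ∂stdGaussianPi ι) - (∑ i, m i ^ 2) / 2) ≤
      ∫ ξ, Real.exp (-g ξ) ∂stdGaussianPi ι := by
  -- The log-density of the shifted law. Its mean -|m|² / 2 is the price of the shift.
  set Z : (ι → ℝ) → ℝ := fun ξ => -(∑ i, m i * ξ i) - (∑ i, m i ^ 2) / 2 with hZ
  have hZm : Measurable Z := by fun_prop
  have hZi : Integrable Z (stdGaussianPi ι) :=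
    ((memLp_linear_stdGaussianPi m).integrable one_le_two).neg.sub (integrable_const _)
  have hsub : Measurable fun ξ : ι → ℝ => ξ - m := by fun_prop
  have hprob : IsProbabilityMeasure ((stdGaussianPi ι).map fun ξ => ξ - m) :=
    Measure.isProbabilityMeasure_map hsub.aemeasurable
  -- The shifted law has total mass 1, which makes ∫ exp Z finite.
  have hexpZ : Integrable (fun ξ => Real.exp (Z ξ)) (stdGaussianPi ι) := by
    refine ⟨by fun_prop, ?_⟩
    rw [hasFiniteIntegral_iff_ofReal (.of_forall fun ξ => (Real.exp_pos _).le)]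
    have h1 : ((stdGaussianPi ι).map fun ξ => ξ - m) Set.univ = 1 := measure_univ
    rw [map_sub_stdGaussianPi, withDensity_apply _ .univ, Measure.restrict_univ] at h1
    exact h1 ▸ ENNReal.one_lt_top
  have hshift : ∫ ξ, Real.exp (-g ξ) ∂stdGaussianPi ι =
      ∫ ξ, Real.exp (Z ξ - g (ξ + m)) ∂stdGaussianPi ι := by
    have h1 : ∫ ξ, Real.exp (-g (ξ + m)) ∂((stdGaussianPi ι).map fun ξ => ξ - m) =
        ∫ ξ, Real.exp (-g ξ) ∂stdGaussianPi ι := by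
      rw [integral_map hsub.aemeasurable
        (by fun_prop : Measurable fun ξ => Real.exp (-g (ξ + m))).aestronglyMeasurable]
      simp
    rw [← h1, map_sub_stdGaussianPi,
      integral_withDensity_eq_integral_toReal_smul (by fun_prop) (by simp)]
    refine integral_congr_ae (.of_forall fun ξ => ?_)
    simp only [smul_eq_mul]
    rw [ENNReal.toReal_ofReal (Real.exp_pos _).le, ← Real.exp_add, ← sub_eq_add_neg]
  have hcomp : Integrable (fun ξ => Real.exp (Z ξ - g (ξ + m))) (stdGaussianPi ι) := by
    refine hexpZ.mono (by fun_prop) (.of_forall fun ξ => ?_)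
    rw [Real.norm_eq_abs, Real.norm_eq_abs, Real.abs_exp, Real.abs_exp]
    exact Real.exp_le_exp.2 (by linarith [hg0 (ξ + m)])
  have hj := convexOn_exp.map_integral_le (μ := stdGaussianPi ι) (f := fun ξ => Z ξ - g (ξ + m))
    Real.continuous_exp.continuousOn isClosed_univ (.of_forall fun _ => Set.mem_univ _)
    (hZi.sub hi) hcomp
  rw [hshift]
  refine le_of_eq_of_le (congrArg Real.exp ?_) hj
  have hZint : ∫ ξ, Z ξ ∂stdGaussianPi ι = -((∑ i, m i ^ 2) / 2) := by
    have hl := ((memLp_linear_stdGaussianPi m).integrable one_le_two).neg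
    simp only [hZ]
    rw [integral_sub (by exact hl) (integrable_const _), integral_neg,
      integral_linear_stdGaussianPi]
    simp
  rw [integral_sub hZi hi, hZint]
  ring

end Gaussian

/-! ### Mean loss of Gaussian linear experts -/

section GaussianLoss

open MeasureTheory ProbabilityTheory

variable {ι : Type*} [Fintype ι]

theorem integrable_affine_sq_stdGaussianPi (A : ι → ℝ) (b : ℝ) :
    Integrable (fun ξ => (∑ i, A i * ξ i + b) ^ 2) (stdGaussianPi ι) :=
  ((memLp_linear_stdGaussianPi A).add (memLp_const b)).integrable_sq

theorem integral_affine_sq_stdGaussianPi (A : ι → ℝ) (b : ℝ) :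
    ∫ ξ, (∑ i, A i * ξ i + b) ^ 2 ∂stdGaussianPi ι = b ^ 2 + ∑ i, A i ^ 2 := by
  have hl := (memLp_linear_stdGaussianPi A)
  have e : ∀ ξ : ι → ℝ, (∑ i, A i * ξ i + b) ^ 2 =
      (∑ i, A i * ξ i) ^ 2 + (2 * b * (∑ i, A i * ξ i) + b ^ 2) := fun ξ => by ring
  simp_rw [e]
  have h1 := (hl.integrable one_le_two).const_mul (2 * b)
  rw [integral_add hl.integrable_sq (by exact h1.add (integrable_const _)),
    integral_add h1 (integrable_const _), integral_linear_sq_stdGaussianPi, integral_const_mul,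
    integral_linear_stdGaussianPi]
  simp
  ring

/-- A lower bound for the mixture, with respect to a Gaussian prior, of the exponentiated losses of
linear experts. -/
theorem exp_le_integral_exp_neg_loss_stdGaussianPi {α : ℕ → ℝ}
    (hα : ∀ t, α t ∈ Set.Ioc (0 : ℝ) 1) (y : ℕ → ℝ) {η C : ℝ} (hη : 0 ≤ η) (A : ℕ → ι → ℝ)
    (hA : ∀ t, ∑ i, A t i ^ 2 ≤ C) (m : ι → ℝ) (T : ℕ) :
    Real.exp (-(η * (discountedLoss α (fun t => ∑ i, A t i * m i) y T
        + C * effectiveTime α T)) - (∑ i, m i ^ 2) / 2) ≤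
      ∫ ξ, Real.exp (-(η * discountedLoss α (fun t => ∑ i, A t i * ξ i) y T))
        ∂stdGaussianPi ι := by
  have e : ∀ ξ : ι → ℝ, discountedLoss α (fun t => ∑ i, A t i * (ξ + m) i) y T =
      ∑ t ∈ range (T + 1), weight α t / weight α T *
        (∑ i, A t i * ξ i + (∑ i, A t i * m i - y t)) ^ 2 := fun ξ => by
    refine sum_congr rfl fun t _ => ?_
    simp only [Pi.add_apply, mul_add, sum_add_distrib]
    ring
  have hti : ∀ t ∈ range (T + 1), Integrable (fun ξ : ι → ℝ => weight α t / weight α T *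
      (∑ i, A t i * ξ i + (∑ i, A t i * m i - y t)) ^ 2) (stdGaussianPi ι) := fun t _ =>
    (integrable_affine_sq_stdGaussianPi (A t) _).const_mul _
  have hm : Measurable fun ξ : ι → ℝ =>
      η * discountedLoss α (fun t => ∑ i, A t i * ξ i) y T :=
    (measurable_discountedLoss α y (p := fun t (ξ : ι → ℝ) => ∑ i, A t i * ξ i)
      (fun t => by fun_prop) T).const_mul η
  have h := exp_le_integral_exp_neg_stdGaussianPi hm
    (fun ξ => mul_nonneg hη (discountedLoss_nonneg hα _ _ _)) m (by
      simp_rw [e]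
      exact (integrable_finsetSum _ hti).const_mul η)
  refine le_trans (Real.exp_le_exp.2 (sub_le_sub_right (neg_le_neg ?_) _)) h
  simp_rw [e]
  rw [integral_const_mul, integral_finsetSum _ hti]
  refine mul_le_mul_of_nonneg_left ?_ hη
  -- Squared bias plus variance: the bias terms form the loss of the centre m, and each variance is
  -- at most C.
  simp_rw [integral_const_mul, integral_affine_sq_stdGaussianPi, mul_add]
  rw [sum_add_distrib]
  refine add_le_add le_rfl ?_
  rw [effectiveTime, sum_div, mul_sum]
  refine sum_le_sum fun t _ => ?_
  rw [mul_comm C]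
  exact mul_le_mul_of_nonneg_left (hA t) (div_nonneg (weight_pos hα t).le (weight_pos hα T).le)

end GaussianLoss

/-! ### Gram–Schmidt coordinates -/

section GramSchmidt

open InnerProductSpace

variable {E : Type*} [NormedAddCommGroup E] [InnerProductSpace ℝ E]

/-- Gram–Schmidt only looks back, which makes the experts causal. -/
theorem gramSchmidt_congr {v v' : ℕ → E} {n : ℕ} (h : ∀ i ≤ n, v i = v' i) :
    gramSchmidt ℝ v n = gramSchmidt ℝ v' n := by
  induction n using Nat.strong_induction_on with
  | _ n ih =>
    rw [gramSchmidt_def, gramSchmidt_def, h n le_rfl]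
    congr 1
    refine sum_congr rfl fun i hi => ?_
    have hi' := mem_Iio.1 hi
    rw [ih i hi' fun j hj => h j (hj.trans hi'.le)]

theorem gramSchmidtNormed_congr {v v' : ℕ → E} {n : ℕ} (h : ∀ i ≤ n, v i = v' i) :
    gramSchmidtNormed ℝ v n = gramSchmidtNormed ℝ v' n := by
  rw [gramSchmidtNormed, gramSchmidtNormed, gramSchmidt_congr h]

theorem inner_gramSchmidtNormed_of_lt (v : ℕ → E) {i t : ℕ} (h : t < i) :
    inner ℝ (gramSchmidtNormed ℝ v i) (v t) = 0 := by
  rw [gramSchmidtNormed, inner_smul_left, gramSchmidt_inv_triangular ℝ v h, mul_zero]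

theorem inner_gramSchmidtNormed_of_ne (v : ℕ → E) {i j : ℕ} (h : i ≠ j) :
    inner ℝ (gramSchmidtNormed ℝ v i) (gramSchmidtNormed ℝ v j) = 0 := by
  rw [gramSchmidtNormed, gramSchmidtNormed, inner_smul_left, inner_smul_right,
    gramSchmidt_orthogonal ℝ v h, mul_zero, mul_zero]

/-- Linearly dependent inputs produce zero vectors, so this identity replaces ‖e‖ = 1. -/
theorem inner_self_smul_gramSchmidtNormed (v : ℕ → E) (i : ℕ) :
    inner ℝ (gramSchmidtNormed ℝ v i) (gramSchmidtNormed ℝ v i) • gramSchmidtNormed ℝ v i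
      = gramSchmidtNormed ℝ v i := by
  by_cases h : gramSchmidtNormed ℝ v i = 0
  · simp [h]
  · rw [real_inner_self_eq_norm_sq, gramSchmidtNormed_unit_length' h]
    simp

/-- Bessel's inequality: the zero vectors contribute nothing and the others are orthonormal. -/
theorem sum_inner_gramSchmidtNormed_sq_le (v : ℕ → E) (f : E) (s : Finset ℕ) :
    ∑ i ∈ s, inner ℝ (gramSchmidtNormed ℝ v i) f ^ 2 ≤ ‖f‖ ^ 2 := by
  classical
  have h := (gramSchmidtNormed_orthonormal' (𝕜 := ℝ) v).sum_inner_products_le f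
    (s := s.subtype fun i => i ∈ {i | gramSchmidtNormed ℝ v i ≠ 0})
  refine le_trans (le_of_eq ?_) h
  simp only [Real.norm_eq_abs, sq_abs]
  rw [sum_subtype_eq_sum_filter (f := fun i => inner ℝ (gramSchmidtNormed ℝ v i) f ^ 2), sum_filter]
  refine sum_congr rfl fun i _ => ?_
  by_cases h0 : gramSchmidtNormed ℝ v i = 0 <;> simp [h0]

theorem sum_inner_mul_inner_gramSchmidtNormed (v : ℕ → E) (f : E) {t T : ℕ} (h : t ≤ T) :
    ∑ i ∈ range (T + 1), inner ℝ (gramSchmidtNormed ℝ v i) (v t) *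
      inner ℝ (gramSchmidtNormed ℝ v i) f = inner ℝ (v t) f := by
  have hmem : v t ∈ Submodule.span ℝ (gramSchmidtNormed ℝ v '' Set.Iic T) := by
    rw [span_gramSchmidtNormed]
    exact mem_span_gramSchmidt ℝ v h
  have key : ∀ u ∈ Submodule.span ℝ (gramSchmidtNormed ℝ v '' Set.Iic T),
      ∑ i ∈ range (T + 1), inner ℝ (gramSchmidtNormed ℝ v i) u *
      inner ℝ (gramSchmidtNormed ℝ v i) f = inner ℝ u f := by
    intro u hu
    induction hu using Submodule.span_induction with
    | mem u hu =>
      obtain ⟨j, hj, rfl⟩ := hu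
      have hj' : j ∈ range (T + 1) := mem_range.2 (Nat.lt_succ_of_le hj)
      rw [sum_eq_single_of_mem j hj' fun i _ hij => by
        rw [inner_gramSchmidtNormed_of_ne v hij, zero_mul]]
      conv_rhs => rw [← inner_self_smul_gramSchmidtNormed v j]
      rw [inner_smul_left]
      rfl
    | zero => simp
    | add u w _ _ hu hw => simp only [inner_add_right, inner_add_left, add_mul, sum_add_distrib, hu, hw]
    | smul c u _ hu =>
      simp only [inner_smul_right, inner_smul_left, mul_assoc, ← mul_sum, hu]
      rfl
  exact key _ hmem

end GramSchmidt

/-! ### Prior over the scales -/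

section Prior

open MeasureTheory ProbabilityTheory

/-- The probability measure on `ℕ` with masses `1 / ((n + 1) (n + 2))`. -/
noncomputable def scalePrior : Measure ℕ :=
  Measure.sum fun n : ℕ => ENNReal.ofReal (1 / ((n + 1) * (n + 2))) • Measure.dirac n

theorem hasSum_one_div_succ_mul : HasSum (fun n : ℕ => (1 / ((n + 1) * (n + 2)) : ℝ)) 1 := by
  rw [hasSum_iff_tendsto_nat_of_nonneg fun n => by positivity]
  have h : ∀ N : ℕ, ∑ n ∈ range N, (1 / ((n + 1) * (n + 2)) : ℝ) = 1 - 1 / ((N : ℝ) + 1) := by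
    intro N
    induction N with
    | zero => simp
    | succ N ih =>
      rw [sum_range_succ, ih]
      push_cast
      field_simp
      ring
  simp_rw [h]
  simpa using (tendsto_one_div_add_atTop_nhds_zero_nat (𝕜 := ℝ)).const_sub 1

instance : IsProbabilityMeasure scalePrior := ⟨by
  rw [scalePrior, Measure.sum_apply _ .univ]
  simp only [Measure.smul_apply, measure_univ, smul_eq_mul, mul_one]
  rw [← ENNReal.ofReal_tsum_of_nonneg (fun n => by positivity) hasSum_one_div_succ_mul.summable,
    hasSum_one_div_succ_mul.tsum_eq, ENNReal.ofReal_one]⟩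

theorem scalePrior_real_singleton (n : ℕ) :
    scalePrior.real {n} = 1 / ((n + 1) * (n + 2)) := by
  rw [Measure.real, scalePrior, Measure.sum_apply _ (measurableSet_singleton n),
    tsum_eq_single n fun k hk => by simp [hk]]
  simp only [Measure.smul_apply, smul_eq_mul]
  rw [Measure.dirac_apply_of_mem (Set.mem_singleton n), mul_one,
    ENNReal.toReal_ofReal (by positivity)]

/-- Only the slice at scale n is kept; its mass is what becomes the logarithmic penalty. -/
theorem mul_integral_le_integral_scalePrior_prod {Ω : Type*} [MeasurableSpace Ω] (Q : Measure Ω)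
    [IsProbabilityMeasure Q] {h : ℕ × Ω → ℝ} (h0 : ∀ z, 0 ≤ h z)
    (hi : Integrable h (scalePrior.prod Q)) (n : ℕ) :
    1 / ((n + 1) * (n + 2)) * ∫ ω, h (n, ω) ∂Q ≤ ∫ z, h z ∂scalePrior.prod Q := by
  rw [integral_prod _ hi, ← scalePrior_real_singleton, ← smul_eq_mul,
    ← integral_singleton (μ := scalePrior) (fun n => ∫ ω, h (n, ω) ∂Q) n]
  exact setIntegral_le_integral hi.integral_prod_left
    (.of_forall fun n => integral_nonneg fun ω => h0 _)

end Prior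

/-! ### Gaussian experts and the regression bound -/

section Regression

open MeasureTheory ProbabilityTheory InnerProductSpace

variable {X : Type*} (F : Type*) [NormedAddCommGroup F] [InnerProductSpace ℝ F]
  [CompleteSpace F] [RKHS ℝ F X ℝ]

theorem norm_kerFun_sq (x : X) : ‖RKHS.kerFun F x (1 : ℝ)‖ ^ 2 = realKernel F x x := by
  rw [← real_inner_self_eq_norm_sq, RKHS.kerFun_inner, RKHS.kerFun_apply, realKernel]
  simp

theorem norm_kerFun_sq_le (hF : BddAbove (Set.range fun x : X => realKernel F x x)) (x : X) :
    ‖RKHS.kerFun F x (1 : ℝ)‖ ^ 2 ≤ kernelBound F ^ 2 := by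
  have h := le_ciSup hF x
  rw [kernelBound, Real.sq_sqrt, norm_kerFun_sq]
  · exact h
  · exact le_trans (norm_kerFun_sq F x ▸ sq_nonneg _) h

/-- The Gram–Schmidt orthonormalization of the kernel sections at the instances `x`. -/
noncomputable def kernelBasis (x : ℕ → X) : ℕ → F :=
  gramSchmidtNormed ℝ fun i => RKHS.kerFun F (x i) (1 : ℝ)

/-- The coordinates of the kernel section at `x t` in `kernelBasis F x`. -/
noncomputable def kernelCoord (x : ℕ → X) (t i : ℕ) : ℝ :=
  inner ℝ (kernelBasis F x i) (RKHS.kerFun F (x t) (1 : ℝ))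

/-- The value at `x t` of a centred Gaussian random function whose covariance is a multiple of the
kernel. The multiple is indexed by the first component of the sample point. -/
noncomputable def gaussianExpert (D : ℝ) (x : ℕ → X) (t : ℕ) (z : ℕ × (ℕ → ℝ)) : ℝ :=
  D / (2 * √(z.1 + 1)) * ∑ i ∈ range (t + 1), kernelCoord F x t i * z.2 i

theorem gaussianExpert_congr (D : ℝ) (x x' : ℕ → X) (t : ℕ) (h : ∀ i ≤ t, x i = x' i) :
    gaussianExpert F D x t = gaussianExpert F D x' t := by
  funext z
  unfold gaussianExpert kernelCoord kernelBasis
  congr 1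
  refine sum_congr rfl fun i hi => ?_
  have hi' : i ≤ t := Nat.le_of_lt_succ (mem_range.1 hi)
  rw [h t le_rfl, gramSchmidtNormed_congr (v' := fun i => RKHS.kerFun F (x' i) (1 : ℝ))
    fun j hj => by rw [h j (hj.trans hi')]]

theorem measurable_gaussianExpert (D : ℝ) (x : ℕ → X) (t : ℕ) :
    Measurable (gaussianExpert F D x t) := by
  unfold gaussianExpert
  have h : Measurable fun z : ℕ × (ℕ → ℝ) => D / (2 * √((z.1 : ℝ) + 1)) :=
    (measurable_from_nat (f := fun n : ℕ => D / (2 * √((n : ℝ) + 1)))).comp measurable_fst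
  exact h.mul (by fun_prop)

/-- The law of a sequence of independent standard Gaussian variables. -/
noncomputable def gaussianSeq : Measure (ℕ → ℝ) := Measure.infinitePi fun _ => gaussianReal 0 1

instance : IsProbabilityMeasure gaussianSeq := by unfold gaussianSeq; infer_instance

theorem discountedLoss_congr (α y : ℕ → ℝ) {p p' : ℕ → ℝ} {T : ℕ} (h : ∀ t ≤ T, p t = p' t) :
    discountedLoss α p y T = discountedLoss α p' y T :=
  sum_congr rfl fun t ht => by rw [h t (Nat.le_of_lt_succ (mem_range.1 ht))]

variable {F}

theorem exp_le_integral_gaussianExpert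
    (hF : BddAbove (Set.range fun x : X => realKernel F x x)) {D : ℝ} (hD : 0 < D)
    {α : ℕ → ℝ} (hα : ∀ t, α t ∈ Set.Ioc (0 : ℝ) 1) (x : ℕ → X) (y : ℕ → ℝ) (T : ℕ) (f : F)
    (n : ℕ) :
    Real.exp (-(2 / D ^ 2 * (discountedLoss α (fun t => f (x t)) y T
      + D ^ 2 * kernelBound F ^ 2 / (4 * (n + 1)) * effectiveTime α T + (n + 1) * ‖f‖ ^ 2))) ≤
      ∫ ξ, Real.exp (-(2 / D ^ 2 *
        discountedLoss α (fun t => gaussianExpert F D x t (n, ξ)) y T)) ∂gaussianSeq := by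
  -- With η = 2 / D², this σ makes the shift cost ‖f‖² / (2ησ²) equal to (n + 1)‖f‖².
  set σ : ℝ := D / (2 * √((n : ℝ) + 1)) with hσ
  have hσ0 : 0 < σ := by positivity
  have hσ2 : σ ^ 2 = D ^ 2 / (4 * (n + 1)) := by
    rw [hσ, div_pow, mul_pow, Real.sq_sqrt (by positivity)]; norm_num
  set s := range (T + 1) with hs
  let A : ℕ → s → ℝ := fun t i => σ * kernelCoord F x t i
  -- The shift whose linear expert takes the values f (x t) for t ≤ T, by the reproducing property.
  let m : s → ℝ := fun i => inner ℝ (kernelBasis F x i) f / σ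
  have hexp : ∀ ξ : ℕ → ℝ, discountedLoss α (fun t => gaussianExpert F D x t (n, ξ)) y T =
      discountedLoss α (fun t => ∑ i, A t i * s.restrict ξ i) y T := fun ξ => by
    refine discountedLoss_congr α y fun t ht => ?_
    simp only [A, Finset.restrict, gaussianExpert]
    rw [sum_coe_sort s fun i => σ * kernelCoord F x t i * ξ i, mul_sum, ← hσ]
    simp_rw [mul_assoc]
    -- The coordinates of the section at x t with index beyond t vanish, so all rounds up to T share
    -- one finite index set.
    refine sum_subset (range_subset_range.2 (by omega)) fun i _ hi => ?_
    have hti : t < i := by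
      have := mem_range.not.1 hi
      omega
    rw [kernelCoord, kernelBasis,
      inner_gramSchmidtNormed_of_lt (fun i => RKHS.kerFun F (x i) (1 : ℝ)) hti]
    simp
  have hf : discountedLoss α (fun t => f (x t)) y T =
      discountedLoss α (fun t => ∑ i, A t i * m i) y T := by
    refine discountedLoss_congr α y fun t ht => ?_
    have h := sum_inner_mul_inner_gramSchmidtNormed
      (fun i => RKHS.kerFun F (x i) (1 : ℝ)) f ht
    rw [RKHS.kerFun_inner] at h
    rw [sum_coe_sort s fun i => σ * kernelCoord F x t i * (inner ℝ (kernelBasis F x i) f / σ)]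
    refine Eq.trans (by simp) (h.symm.trans (sum_congr rfl fun i _ => ?_))
    rw [kernelCoord, kernelBasis]
    field_simp
  have hA : ∀ t, ∑ i, A t i ^ 2 ≤ σ ^ 2 * kernelBound F ^ 2 := fun t => by
    rw [sum_coe_sort s fun i => (σ * kernelCoord F x t i) ^ 2]
    simp_rw [mul_pow]
    rw [← mul_sum]
    exact mul_le_mul_of_nonneg_left
      ((sum_inner_gramSchmidtNormed_sq_le _ _ s).trans (norm_kerFun_sq_le F hF (x t)))
      (sq_nonneg σ)
  have hm : ∑ i, m i ^ 2 ≤ ‖f‖ ^ 2 / σ ^ 2 := by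
    rw [sum_coe_sort s fun i => (inner ℝ (kernelBasis F x i) f / σ) ^ 2]
    simp_rw [div_pow]
    rw [← sum_div]
    exact div_le_div_of_nonneg_right (sum_inner_gramSchmidtNormed_sq_le _ _ s) (sq_nonneg σ)
  have h := exp_le_integral_exp_neg_loss_stdGaussianPi hα y (η := 2 / D ^ 2) (by positivity) A hA m T
  have hmeas : Measurable fun ξ : s → ℝ =>
      Real.exp (-(2 / D ^ 2 * discountedLoss α (fun t => ∑ i, A t i * ξ i) y T)) :=
    (((measurable_discountedLoss α y (p := fun t (ξ : s → ℝ) => ∑ i, A t i * ξ i)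
      (fun t => by fun_prop) T).const_mul _).neg).exp
  simp_rw [hexp]
  rw [gaussianSeq, integral_restrict_infinitePi (μ := fun _ : ℕ => gaussianReal 0 1) (s := s)
    (f := fun ξ : s → ℝ =>
      Real.exp (-(2 / D ^ 2 * discountedLoss α (fun t => ∑ i, A t i * ξ i) y T)))
    hmeas.aestronglyMeasurable]
  refine le_trans (Real.exp_le_exp.2 ?_) h
  have h2 : 2 / D ^ 2 * ((n + 1) * ‖f‖ ^ 2) = ‖f‖ ^ 2 / σ ^ 2 / 2 := by
    rw [hσ2]; field_simp; ring
  rw [mul_add, h2, hf, mul_div_right_comm (D ^ 2), ← hσ2]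
  linarith

variable (F) in
/-- Mixture of the Gaussian experts over all scales. -/
noncomputable def regressionStrategy (Y₁ Y₂ : ℝ) : Strategy X :=
  mixingStrategy (scalePrior.prod gaussianSeq) Y₁ Y₂ (gaussianExpert F (Y₂ - Y₁))

/-- The loss bound with a fixed regularization parameter `n + 1`. -/
theorem discountedLoss_regressionStrategy_le
    (hF : BddAbove (Set.range fun x : X => realKernel F x x)) {Y₁ Y₂ : ℝ} (hY : Y₁ < Y₂)
    {α : ℕ → ℝ} (hα : ∀ t, α t ∈ Set.Ioc (0 : ℝ) 1) (x : ℕ → X) {y : ℕ → ℝ}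
    (hy : ∀ t, y t ∈ Set.Icc Y₁ Y₂) (T : ℕ) (f : F) (n : ℕ) :
    discountedLoss α ((regressionStrategy F Y₁ Y₂).prediction α x y) y T ≤
      discountedLoss α (fun t => f (x t)) y T
      + (Y₂ - Y₁) ^ 2 * kernelBound F ^ 2 / (4 * (n + 1)) * effectiveTime α T
      + (n + 1) * ‖f‖ ^ 2 + (Y₂ - Y₁) ^ 2 / 2 * Real.log ((n + 1) * (n + 2)) := by
  have hD : 0 < Y₂ - Y₁ := sub_pos.2 hY
  have h1 := integral_exp_neg_discountedLoss_le (scalePrior.prod gaussianSeq) hY hα hy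
    (measurable_gaussianExpert F (Y₂ - Y₁) x)
    (prediction_mixingStrategy (scalePrior.prod gaussianSeq) Y₁ Y₂
      (gaussianExpert_congr F (Y₂ - Y₁)) α x y) T
  have h2 := mul_integral_le_integral_scalePrior_prod gaussianSeq
    (fun z => (Real.exp_pos _).le)
    (integrable_exp_neg_of_nonneg (P := scalePrior.prod gaussianSeq)
      (g := fun z => 2 / (Y₂ - Y₁) ^ 2 *
        discountedLoss α (fun t => gaussianExpert F (Y₂ - Y₁) x t z) y T)
      ((measurable_discountedLoss α y (measurable_gaussianExpert F (Y₂ - Y₁) x) T).const_mul _)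
      fun z => mul_nonneg (by positivity) (discountedLoss_nonneg hα _ _ _)) n
  have h3 := exp_le_integral_gaussianExpert hF hD hα x y T f n
  have h4 := (mul_le_mul_of_nonneg_left h3
    (by positivity : (0 : ℝ) ≤ 1 / ((n + 1) * (n + 2)))).trans (h2.trans h1)
  rw [one_div, ← Real.exp_log (by positivity : (0 : ℝ) < (n + 1) * (n + 2)), ← Real.exp_neg,
    ← Real.exp_add, Real.exp_le_exp] at h4
  set l := Real.log (((n : ℝ) + 1) * (n + 2)) with hl
  have h5 := mul_le_mul_of_nonneg_left h4 (by positivity : 0 ≤ (Y₂ - Y₁) ^ 2 / 2)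
  have h6 : ∀ u : ℝ, (Y₂ - Y₁) ^ 2 / 2 * (2 / (Y₂ - Y₁) ^ 2 * u) = u := fun u => by field_simp
  rw [mul_add, mul_neg, mul_neg, mul_neg, h6, h6] at h5
  change _ ≤ -discountedLoss α ((regressionStrategy F Y₁ Y₂).prediction α x y) y T at h5
  linarith

theorem one_le_effectiveTime {α : ℕ → ℝ} (hα : ∀ t, α t ∈ Set.Ioc (0 : ℝ) 1) (T : ℕ) :
    1 ≤ effectiveTime α T := by
  rw [effectiveTime, one_le_div (weight_pos hα T)]
  exact single_le_sum (f := weight α) (fun t _ => (weight_pos hα t).le) (self_mem_range_succ T)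

/-- The choice of the regularization parameter. -/
theorem exists_regularization_le {c D N E : ℝ} (hc : 0 ≤ c) (hD : 0 ≤ D) (hN : 0 < N)
    (hE : 1 ≤ E) :
    ∃ n : ℕ, D ^ 2 * c ^ 2 / (4 * (n + 1)) * E + (n + 1) * N ^ 2
        + D ^ 2 / 2 * Real.log ((n + 1) * (n + 2)) ≤
      c * N * D * √E + D ^ 2 / 2 * Real.log E + N ^ 2 + D ^ 2 * Real.log (c * D / N + 2) := by
  set r := √E with hr
  have hr1 : 1 ≤ r := Real.one_le_sqrt.2 hE
  have hrE : r ^ 2 = E := Real.sq_sqrt (by linarith)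
  -- The minimizer of D²c²E / (4u) + uN² over u > 0, where both terms equal cNDr / 2. Since b < ⌊b⌋
  -- + 1 ≤ b + 1, rounding costs at most N².
  set b := D * c * r / (2 * N) with hb
  have hb0 : 0 ≤ b := by positivity
  have hbN : 2 * N * b = D * c * r := by rw [hb]; field_simp
  refine ⟨⌊b⌋₊, ?_⟩
  have h1 : (⌊b⌋₊ : ℝ) ≤ b := Nat.floor_le hb0
  have h2 : b < ⌊b⌋₊ + 1 := Nat.lt_floor_add_one b
  set k : ℝ := (⌊b⌋₊ : ℝ) with hk
  have hk0 : 0 ≤ k := Nat.cast_nonneg _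
  have e1 : D ^ 2 * c ^ 2 / (4 * (k + 1)) * E ≤ c * N * D * r / 2 := by
    rw [div_mul_eq_mul_div, div_le_iff₀ (by positivity), ← hrE]
    have : D * c * r * (D * c * r) ≤ D * c * r * (2 * N * (k + 1)) := by
      refine mul_le_mul_of_nonneg_left ?_ (by positivity)
      rw [← hbN]
      exact mul_le_mul_of_nonneg_left h2.le (by positivity)
    nlinarith
  have e2 : (k + 1) * N ^ 2 ≤ c * N * D * r / 2 + N ^ 2 := by
    have : k * N ^ 2 ≤ b * N ^ 2 := mul_le_mul_of_nonneg_right h1 (sq_nonneg N)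
    have h3 : b * N ^ 2 = c * N * D * r / 2 := by rw [hb]; field_simp
    linarith
  have e3 : Real.log ((k + 1) * (k + 2)) ≤ Real.log E + 2 * Real.log (c * D / N + 2) := by
    have hq : 0 ≤ c * D / N := by positivity
    -- Since r ≥ 1, the summand 2 is at most 2r, so r factors out and yields log E.
    have h4 : k + 2 ≤ r * (c * D / N + 2) := by
      have : b = r * (c * D / N) / 2 := by rw [hb]; field_simp
      have : 0 ≤ r * (c * D / N) := by positivity
      linarith
    have h5 : (k + 1) * (k + 2) ≤ E * (c * D / N + 2) ^ 2 := by
      rw [← hrE, ← mul_pow]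
      nlinarith
    refine (Real.log_le_log (by positivity) h5).trans (le_of_eq ?_)
    rw [Real.log_mul (by positivity) (by positivity), Real.log_pow]
    norm_num
  have e4 := mul_le_mul_of_nonneg_left e3 (by positivity : 0 ≤ D ^ 2 / 2)
  linarith

end Regression

end DiscountedRegression

theorem corollary2
    {X : Type*} (F : Type*) [NormedAddCommGroup F] [InnerProductSpace ℝ F] [CompleteSpace F]
    [RKHS ℝ F X ℝ]
    (hF : BddAbove (Set.range fun x : X => DiscountedRegression.realKernel F x x))
    (Y₁ Y₂ : ℝ) (hY : Y₁ ≤ Y₂) :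
    ∃ S : DiscountedRegression.Strategy X,
      ∀ (α : ℕ → ℝ) (x : ℕ → X) (y : ℕ → ℝ),
        (∀ t, α t ∈ Set.Ioc (0 : ℝ) 1) → (∀ t, y t ∈ Set.Icc Y₁ Y₂) →
        ∀ (T : ℕ) (f : F), f ≠ 0 →
          DiscountedRegression.discountedLoss α (S.prediction α x y) y T ≤
            DiscountedRegression.discountedLoss α (fun t => f (x t)) y T
              + DiscountedRegression.kernelBound F * ‖f‖ * (Y₂ - Y₁)
                  * Real.sqrt (DiscountedRegression.effectiveTime α T)
              + (Y₂ - Y₁) ^ 2 / 2 * Real.log (DiscountedRegression.effectiveTime α T)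
              + ‖f‖ ^ 2
              + (Y₂ - Y₁) ^ 2
                  * Real.log (DiscountedRegression.kernelBound F * (Y₂ - Y₁) / ‖f‖ + 2) := by
  rcases hY.eq_or_lt with rfl | hlt
  -- When Y₁ = Y₂ the rate 2 / (Y₂ - Y₁)² degenerates, but the constant prediction has zero loss.
  · refine ⟨fun _ _ _ _ => Y₁, fun α x y hα hy T f _ => ?_⟩
    have h0 : DiscountedRegression.discountedLoss α
        (DiscountedRegression.Strategy.prediction (fun _ _ _ _ => Y₁) α x y) y T = 0 :=
      sum_eq_zero fun t _ => by
        rw [le_antisymm (hy t).2 (hy t).1, show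
          DiscountedRegression.Strategy.prediction (fun _ _ _ _ => Y₁) α x y t = Y₁ from rfl]
        simp
    have h1 := DiscountedRegression.discountedLoss_nonneg hα (fun t => f (x t)) y T
    rw [h0]
    simp
    positivity
  · refine ⟨DiscountedRegression.regressionStrategy F Y₁ Y₂, fun α x y hα hy T f hf => ?_⟩
    have hc : 0 ≤ DiscountedRegression.kernelBound F := Real.sqrt_nonneg _
    obtain ⟨n, hn⟩ := DiscountedRegression.exists_regularization_le
      hc (sub_nonneg.2 hY)
      (norm_pos_iff.2 hf) (DiscountedRegression.one_le_effectiveTime hα T)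
    have := DiscountedRegression.discountedLoss_regressionStrategy_le hF hlt hα x hy T f n
    linarith
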